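/- For $n\ge 2$ let $K_n$ be the complete graph on the vertex set $\{1,\dots,n\}$ and $\Delta$ its Laplacian (degree matrix minus adjacency matrix), acting on $\mathbb Z^n$. For $\mathbf d=(d_1,\dots,d_n)\in\mathbb Z^n$ put $\deg(\mathbf d)=d_1+\cdots+d_n$. Call $\mathbf d,\mathbf d'\in\mathbb Z^n$ equivalent if $\mathbf d-\mathbf d'\in\Delta(\mathbb Z^n)$, and let $\mathcal N$ be the set of $\mathbf d\in\mathbb Z^n$ that are not equivalent to any vector with nonnegative coordinates. The Baker–Norine rank of $\mathbf d$ is $$r_{\mathrm{BN},K_n}(\mathbf d)=-1+\min_{\mathbf d'\in\mathcal N}\sum_{j=1}^n|d_j-d_j'| .$$ Let $$\mathcal A=\mathcal A(n)=\{\mathbf a\in\mathbb Z^n : a_1,\dots,a_{n-2}\in\{0,\dots,n-1\},\ a_{n-1}=0\}.$$ For $x\in\mathbb Z$ let $x\bmod n$ be the element of $\{0,\dots,n-1\}$ congruent to $x$ modulo $n$; the set $\{0,\dots,m\}$ is understood to be empty if $m<0$. 1. For every $n\ge2$ and every $\mathbf a\in\mathcal A(n)$, $$r_{\mathrm{BN},K_n}(\mathbf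 a)=-1+\Bigl|\Bigl\{i\in\{0,\dots,\deg(\mathbf a)\} : \sum_{j=1}^{n-2}\bigl((a_j+i)\bmod n\bigr)\le\deg(\mathbf a)-i\Bigr\}\Bigr| .$$ 2. For every $n\ge2$ and every $\mathbf d\in\mathbb Z^n$, $$r_{\mathrm{BN},K_n}(\mathbf d)=-1+\Bigl|\Bigl\{i\in\{0,\dots,\deg(\mathbf d)\} : \sum_{j=1}^{n-2}\bigl((d_j-d_{n-1}+i)\bmod n\bigr)\le\deg(\mathbf d)-i\Bigr\}\Bigr| .$$ 3. There is an algorithm that, on input $n\ge2$ and $\mathbf d\in\mathbb Z^n$, computes $r_{\mathrm{BN},K_n}(\mathbf d)$ in time $O(n)$, with a constant that depends on neither $n$ nor $\mathbf d$. Here an algorithm is one fixed program (for all $n$ and $\mathbf d$) of a random access machine with integer registers and an integer-addressed integer memory, in which each of the following costs one unit of time: loading a constant, addition, subtraction, integer division and remainder of registers (the remainder being nonnegative), indirect load and store, a jump, and a jump conditional on the sign of a register. At the start, $n$ is in a register, $d_1,\dots,d_n$ are in the memory cells $0,\dots,n-1$, and all other registers and cells are $0$. -/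

import Mathlib

namespace BakerNorine

/-- The degree `d_1 + ⋯ + d_n` of a vector indexed by a finite set. -/
def deg {V : Type*} [Fintype V] (d : V → ℤ) : ℤ := ∑ v, d v

section Rank

variable {V : Type*} [Fintype V] [DecidableEq V] (G : SimpleGraph V) [DecidableRel G.Adj]

/-- `d ∼ d'`: the difference lies in the image of the Laplacian `D_G - A_G` acting on `ℤ^V`. -/
def Equivalent (d d' : V → ℤ) : Prop :=
  ∃ x : V → ℤ, d - d' = (G.lapMatrix ℤ).mulVec x

/-- The vectors that are not equivalent to an effective (i.e. coordinatewise nonnegative)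
vector. -/
def nonEffective : Set (V → ℤ) :=
  {d | ¬ ∃ d' : V → ℤ, 0 ≤ d' ∧ Equivalent G d d'}

/-- The `L¹` distance on `ℤ^V`. -/
def l1Dist (d d' : V → ℤ) : ℕ := ∑ v, (d v - d' v).natAbs

/-- `f(d)`, the minimal `L¹` distance from `d` to a vector that is not equivalent to an effective
one.  When `V` is nonempty there are such vectors (all those of negative degree), so that this
infimum of natural numbers is a minimum. -/
noncomputable def distNonEffective (d : V → ℤ) : ℕ :=
  sInf {m | ∃ d' ∈ nonEffective G, l1Dist d d' = m}

/-- The Baker-Norine rank of `d`. -/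
noncomputable def rank (d : V → ℤ) : ℤ := (distNonEffective G d : ℤ) - 1

end Rank

/-- The Baker-Norine rank on the complete graph `K_n`. -/
noncomputable def rankComplete (n : ℕ) (d : Fin n → ℤ) : ℤ := rank (⊤ : SimpleGraph (Fin n)) d

/-- The set `{0,…,n-1}^{n-2} × {0} × ℤ` of representatives of `ℤ^n` modulo the image of the
Laplacian of `K_n`.  Coordinates are numbered from `0` here, so the coordinate number `n-1` in the
usual numbering from `1` has index `n-2`. -/
def picReps (n : ℕ) (hn : 2 ≤ n) : Set (Fin n → ℤ) :=
  {a | (∀ j : Fin (n - 2), 0 ≤ a ⟨j, by omega⟩ ∧ a ⟨j, by omega⟩ ≤ (n : ℤ) - 1) ∧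
    a ⟨n - 2, by omega⟩ = 0}

end BakerNorine

/-!  A unit-cost random access machine over the integers.  It has registers (named by a program
explicitly) and a memory (accessed through addresses held in registers); each
holds an integer. -/

namespace RAM

/-- The instructions.  Division and remainder are rounded so that the remainder is nonnegative
(so division by a positive number is floor division).  There is no multiplication. -/
inductive Instr where
  /-- put the constant `c` into register `r` -/
  | const (r : ℕ) (c : ℤ)
  /-- put the sum of registers `s` and `t` into register `r` -/
  | add (r s t : ℕ)
  /-- put the difference of registers `s` and `t` into register `r` -/
  | sub (r s t : ℕ)
  /-- put the quotient of registers `s` and `t` into register `r` -/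
  | div (r s t : ℕ)
  /-- put the remainder of register `s` modulo register `t` into register `r` -/
  | mod (r s t : ℕ)
  /-- put the memory cell whose address is in register `s` into register `r` -/
  | load (r s : ℕ)
  /-- put register `s` into the memory cell whose address is in register `r` -/
  | store (r s : ℕ)
  /-- go to instruction number `l` -/
  | jump (l : ℕ)
  /-- go to instruction number `l` if register `r` is negative -/
  | jumpNeg (r l : ℕ)

/-- A program is a finite list of instructions, numbered from `0`. -/
abbrev Program := List Instr

/-- A configuration: the number of the next instruction, the registers, the memory. -/
structure State where
  pc : ℕ
  reg : ℕ → ℤ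
  mem : ℤ → ℤ

/-- Put `x` into register `r` and go to the next instruction. -/
def State.setReg (σ : State) (r : ℕ) (x : ℤ) : State :=
  ⟨σ.pc + 1, Function.update σ.reg r x, σ.mem⟩

/-- The effect of one instruction. -/
def Instr.exec (σ : State) : Instr → State
  | .const r c => σ.setReg r c
  | .add r s t => σ.setReg r (σ.reg s + σ.reg t)
  | .sub r s t => σ.setReg r (σ.reg s - σ.reg t)
  | .div r s t => σ.setReg r (σ.reg s / σ.reg t)
  | .mod r s t => σ.setReg r (σ.reg s % σ.reg t)
  | .load r s => σ.setReg r (σ.mem (σ.reg s))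
  | .store r s => ⟨σ.pc + 1, σ.reg, Function.update σ.mem (σ.reg r) (σ.reg s)⟩
  | .jump l => ⟨l, σ.reg, σ.mem⟩
  | .jumpNeg r l => ⟨if σ.reg r < 0 then l else σ.pc + 1, σ.reg, σ.mem⟩

/-- One step; it costs one unit of time.  The machine has halted when there is no instruction with
the number `pc`. -/
def step (P : Program) (σ : State) : State :=
  match P[σ.pc]? with
  | none => σ
  | some i => i.exec σ

/-- The initial configuration on input `(n, d)`: register `0` holds `n`, the memory cells with
addresses `0, …, n-1` hold the coordinates of `d`, and all the rest is `0`. -/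
def initial (n : ℕ) (d : Fin n → ℤ) : State where
  pc := 0
  reg := fun r => if r = 0 then (n : ℤ) else 0
  mem := fun k => if h : 0 ≤ k ∧ k < n then d ⟨k.toNat, by omega⟩ else 0

/-- On input `(n, d)`, the program `P` halts after at most `T` steps, with `y` in register `0`. -/
def Outputs (P : Program) (n : ℕ) (d : Fin n → ℤ) (T : ℕ) (y : ℤ) : Prop :=
  ∃ t ≤ T, P.length ≤ ((step P)^[t] (initial n d)).pc ∧ ((step P)^[t] (initial n d)).reg 0 = y

end RAM

/-!
The proof replaces the vectors that are not equivalent to an effective one by explicit maximal ones.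
Equivalence on `K_n` means having the same degree and a difference whose coordinates are all
congruent modulo `n` (`equivalent_top_iff`).  Call `m` extremal if its coordinates are pairwise
incongruent modulo `n` and its degree is `n (n - 3) / 2`; the translates of the permutations of
`(-1, 0, …, n - 2)` are of this kind.  An extremal vector has a negative coordinate, as
`0 + 1 + ⋯ + (n - 1)` is larger than its degree, so nothing below it is equivalent to an effective
vector.  Let `F d`, called `extremalDist`, be the minimum over extremal `m` of the degree of the
positive part of `d - m`.

The value `F d` drops by one on passing to `d - e_k` if
`∑ (d_v - d_k) mod n ≤ deg d`, summed over all coordinates `v` other than `k` and some fixed `l ≠ k`,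
and is unchanged otherwise.  In the first case `d` may be taken effective with `d_k = 0`; if the
extremal vector closest to `d` is nonnegative at `k`, exchanging its value there with a negative one
does not increase the excess (`extremalDist_sub_single_lt`).  The second case is the first one
applied to `K - d + e_k`, where `K = (n - 3, …, n - 3)`, by the duality `m ↦ K - m` of extremal
vectors (`extremalDist_dual`).

Iterating, `F d` is the number of `i ≥ 0` for which `d - i e_k` satisfies the criterion
(`extremalDist_eq_card`).  If there is such an `i`, then `d` is equivalent to an effective
vector.  So `F` vanishes on the vectors that are not: these are exactly the ones below an extremal
vector, and `F` is the distance to them (`distNonEffective_top_eq_extremalDist`).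

For the algorithm, let `u i = n + deg d - ∑_{j ≤ n-2} ((b_j + i) mod n)` with
`b_j = (d_j - d_{n-2}) mod n`, coordinates being numbered from `0`.  In the residue class of `i`
modulo `n`, where `0 ≤ i < n`, the formula counts `max 0 ⌊u i / n⌋` elements
(`card_filter_le_sub_eq_sum`).  The value
`u (i + 1)` differs from `u i` by `1 - n` plus `n` times the number of `j` with `b_j = n - 1 - i`, and
all these multiples of `n` are tabulated in one pass over `d`, so no multiplication is needed.
-/

namespace BakerNorine

/-! ### Extremal vectors -/

section Extremal

variable {V : Type*} [Fintype V]

/-- The vectors whose coordinates are pairwise incongruent modulo `n = |V|` and whose degree is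
`n (n - 3) / 2`.  They are the maximal elements of `nonEffective ⊤`. -/
def IsExtremal (m : V → ℤ) : Prop :=
  (∀ u v, (Fintype.card V : ℤ) ∣ m u - m v → u = v) ∧
    2 * ∑ v, m v = Fintype.card V * (Fintype.card V - 3)

/-- The degree of the positive part of `d - m`. -/
def excess (d m : V → ℤ) : ℕ := ∑ v, (d v - m v).toNat

/-- The minimal excess of `d` over an extremal vector. -/
noncomputable def extremalDist (d : V → ℤ) : ℕ :=
  sInf {c | ∃ m, IsExtremal m ∧ excess d m = c}

/-- An element of the image of the Laplacian of the complete graph, described without the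
Laplacian: its degree is zero and its coordinates are congruent modulo `n = |V|`. -/
def IsPrincipal (x : V → ℤ) : Prop :=
  ∑ v, x v = 0 ∧ ∀ u v, (Fintype.card V : ℤ) ∣ x u - x v

theorem IsPrincipal.neg {x : V → ℤ} (hx : IsPrincipal x) : IsPrincipal (-x) := by
  refine ⟨by simp [hx.1], fun u v => ?_⟩
  have := hx.2 v u
  rwa [Pi.neg_apply, Pi.neg_apply, show -x u - -x v = x v - x u by ring]

theorem IsExtremal.add {m x : V → ℤ} (hm : IsExtremal m) (hx : IsPrincipal x) :
    IsExtremal (m + x) := by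
  refine ⟨fun u v h => hm.1 u v ?_, ?_⟩
  · have := dvd_sub h (hx.2 u v)
    rwa [Pi.add_apply, Pi.add_apply,
      show m u + x u - (m v + x v) - (x u - x v) = m u - m v by ring] at this
  · simp only [Pi.add_apply, Finset.sum_add_distrib, hx.1, add_zero]
    exact hm.2

theorem IsExtremal.comp_equiv {m : V → ℤ} (hm : IsExtremal m) (e : V ≃ V) :
    IsExtremal (m ∘ e) :=
  ⟨fun u v h => e.injective (hm.1 _ _ h), by
    rw [← hm.2]; congr 1; exact Equiv.sum_comp e m⟩

/-- The canonical duality `m ↦ K - m`, where all coordinates of `K` are `n - 3`. -/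
theorem IsExtremal.dual {m : V → ℤ} (hm : IsExtremal m) :
    IsExtremal fun v => (Fintype.card V : ℤ) - 3 - m v := by
  refine ⟨fun u v h => (hm.1 v u ?_).symm, ?_⟩
  · rwa [show (Fintype.card V : ℤ) - 3 - m u - (Fintype.card V - 3 - m v) = m v - m u by ring] at h
  · rw [Finset.sum_sub_distrib, mul_sub, hm.2]
    simp only [Finset.sum_const, Finset.card_univ, nsmul_eq_mul]
    ring

/-- Nonnegative integers that are pairwise incongruent modulo `n = |V|` have a sum of at least
`0 + 1 + ⋯ + (n - 1)`. -/
theorem card_mul_le_sum_of_incongruent {m : V → ℤ}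
    (hm : ∀ u v, (Fintype.card V : ℤ) ∣ m u - m v → u = v) (h0 : ∀ v, 0 ≤ m v) :
    (Fintype.card V : ℤ) * (Fintype.card V - 1) ≤ 2 * ∑ v, m v := by
  classical
  rcases Nat.eq_zero_or_pos (Fintype.card V) with hc | hc
  · rw [hc]
    simpa using Finset.sum_nonneg fun v _ => h0 v
  set n := Fintype.card V with hn
  have hn0 : (0 : ℤ) < n := by exact_mod_cast hc
  have key : ∀ v, ((m v % n).toNat : ℤ) = m v % n := fun v =>
    Int.toNat_of_nonneg (Int.emod_nonneg _ hn0.ne')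
  have hinj : Function.Injective fun v => (m v % n).toNat := by
    intro u v h
    refine hm u v (Int.ModEq.dvd ?_)
    have h' : (m u % n).toNat = (m v % n).toNat := h
    rw [Int.ModEq, ← key u, ← key v, h']
  have himg : Finset.univ.image (fun v => (m v % n).toNat) = Finset.range n := by
    apply Finset.eq_of_subset_of_card_le
    · intro x hx
      obtain ⟨v, -, rfl⟩ := Finset.mem_image.1 hx
      have h1 := key v
      have h2 := Int.emod_lt_of_pos (m v) hn0
      rw [Finset.mem_range]
      omega
    · rw [Finset.card_image_of_injective _ hinj, Finset.card_range, Finset.card_univ]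
  have hsum : ∑ v, (m v % n).toNat = ∑ i ∈ Finset.range n, i := by
    rw [← himg, Finset.sum_image fun u _ v _ h => hinj h]
  have hsum2 : 2 * ∑ v, (m v % n) = (n : ℤ) * (n - 1) := by
    have h := Finset.sum_range_id_mul_two n
    rw [← hsum] at h
    zify [hc] at h
    simp only [key] at h
    linarith
  rw [← hsum2]
  gcongr with v
  have := Int.mul_ediv_add_emod (m v) n
  have := mul_nonneg hn0.le (Int.ediv_nonneg (h0 v) hn0.le)
  omega

theorem IsExtremal.exists_neg [Nonempty V] {m : V → ℤ} (hm : IsExtremal m) : ∃ v, m v < 0 := by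
  by_contra! h
  have h1 := card_mul_le_sum_of_incongruent hm.1 h
  have h2 : (0 : ℤ) < Fintype.card V := by exact_mod_cast Fintype.card_pos
  rw [hm.2] at h1
  nlinarith

/-- Extremal vectors can be arbitrarily large outside a single coordinate. -/
theorem exists_isExtremal_ge (d : V → ℤ) (k : V) :
    ∃ m, IsExtremal m ∧ ∀ v, v ≠ k → d v ≤ m v := by
  classical
  obtain ⟨B, hB⟩ : ∃ B : ℤ, 0 ≤ B ∧ ∀ v, d v + 1 ≤ B := by
    refine ⟨∑ v, |d v| + 1, by positivity, fun v => ?_⟩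
    have := Finset.single_le_sum (f := fun v => |d v|) (fun v _ => abs_nonneg _)
      (Finset.mem_univ v)
    have := le_abs_self (d v)
    grind
  set n := Fintype.card V with hn
  have hn1 : (1 : ℤ) ≤ n := by exact_mod_cast Fintype.card_pos_iff.2 ⟨k⟩
  -- The witness is `(-1, 0, …, n - 2)`, translated by `n B` outside `k`.
  let e := Fintype.equivFin V
  have h0 : IsExtremal fun v => ((e v : ℕ) : ℤ) - 1 := by
    constructor
    · intro u v h
      apply e.injective
      have h1 := (e u).isLt
      have h2 := (e v).isLt
      have h3 : (((e u : ℕ) : ℤ) - (e v : ℕ)) = 0 := by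
        apply Int.eq_zero_of_abs_lt_dvd (m := (n : ℤ))
        · convert h using 1; ring
        · rw [abs_lt]; constructor <;> omega
      apply Fin.ext
      omega
    · rw [Equiv.sum_comp e fun i : Fin n => ((i : ℕ) : ℤ) - 1, Finset.sum_sub_distrib,
        Fin.sum_univ_eq_sum_range (fun i => (i : ℤ)) n]
      have h := Finset.sum_range_id_mul_two n
      zify [Fintype.card_pos_iff.2 ⟨k⟩] at h
      rw [Nat.cast_sub (by omega)] at h
      simp only [Finset.sum_const, Finset.card_univ, nsmul_eq_mul, Fintype.card_fin]
      push_cast at h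
      linarith
  have hx : IsPrincipal fun v => (n : ℤ) * (B - if v = k then n * B else 0) := by
    constructor
    · rw [← Finset.mul_sum, Finset.sum_sub_distrib, Finset.sum_ite_eq']
      simp [hn]
    · intro u v
      exact dvd_sub (dvd_mul_right _ _) (dvd_mul_right _ _)
  refine ⟨_, h0.add hx, fun v hv => ?_⟩
  simp only [Pi.add_apply, if_neg hv, sub_zero]
  have := hB.2 v
  nlinarith [hB.1, Int.natCast_nonneg (e v : ℕ)]

theorem extremalDist_le {d m : V → ℤ} (hm : IsExtremal m) : extremalDist d ≤ excess d m :=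
  Nat.sInf_le ⟨m, hm, rfl⟩

theorem exists_excess_eq [Nonempty V] (d : V → ℤ) :
    ∃ m, IsExtremal m ∧ excess d m = extremalDist d := by
  refine Nat.sInf_mem (s := {c | ∃ m, IsExtremal m ∧ excess d m = c}) ?_
  obtain ⟨m, hm, -⟩ := exists_isExtremal_ge d (Classical.arbitrary V)
  exact ⟨_, m, hm, rfl⟩

theorem excess_eq_zero_iff {d m : V → ℤ} : excess d m = 0 ↔ d ≤ m := by
  simp [excess, Finset.sum_eq_zero_iff, Int.toNat_eq_zero, Pi.le_def]

theorem extremalDist_eq_zero_iff [Nonempty V] {d : V → ℤ} :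
    extremalDist d = 0 ↔ ∃ m, IsExtremal m ∧ d ≤ m := by
  constructor
  · intro h
    obtain ⟨m, hm, he⟩ := exists_excess_eq d
    exact ⟨m, hm, excess_eq_zero_iff.1 (he.trans h)⟩
  · rintro ⟨m, hm, h⟩
    have := extremalDist_le (d := d) hm
    rw [excess_eq_zero_iff.2 h] at this
    omega

theorem extremalDist_add [Nonempty V] (d : V → ℤ) {x : V → ℤ} (hx : IsPrincipal x) :
    extremalDist (d + x) = extremalDist d := by
  have key : ∀ (d : V → ℤ) {x : V → ℤ}, IsPrincipal x →
      extremalDist (d + x) ≤ extremalDist d := by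
    intro d x hx
    obtain ⟨m, hm, he⟩ := exists_excess_eq d
    rw [← he]
    refine (extremalDist_le (hm.add hx)).trans_eq ?_
    simp [excess]
  refine le_antisymm (key d hx) ?_
  simpa using key (d + x) hx.neg

/-- The Riemann-Roch formula for `extremalDist`.  Here it is immediate: the positive and the
negative part of `d - m` differ in degree by `deg d - deg m`. -/
theorem extremalDist_dual [Nonempty V] (d : V → ℤ) :
    2 * (extremalDist d : ℤ) =
      2 * extremalDist (fun v => (Fintype.card V : ℤ) - 3 - d v) + 2 * deg d -
        Fintype.card V * (Fintype.card V - 3) := by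
  set n : ℤ := (Fintype.card V : ℤ)
  have hex : ∀ (d m : V → ℤ), IsExtremal m →
      2 * (excess d m : ℤ) = 2 * excess (fun v => n - 3 - d v) (fun v => n - 3 - m v)
        + 2 * deg d - n * (n - 3) := by
    intro d m hm
    have h : (excess d m : ℤ) = excess (fun v => n - 3 - d v) (fun v => n - 3 - m v)
        + (deg d - ∑ v, m v) := by
      simp only [excess, deg, Nat.cast_sum, ← Finset.sum_sub_distrib, ← Finset.sum_add_distrib]
      exact Finset.sum_congr rfl fun v _ => by omega
    have := hm.2
    linarith
  have key : ∀ d : V → ℤ, 2 * (extremalDist (fun v => n - 3 - d v) : ℤ) ≤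
      2 * extremalDist d - 2 * deg d + n * (n - 3) := by
    intro d
    obtain ⟨m, hm, he⟩ := exists_excess_eq d
    have h1 := hex d m hm
    have h2 : (extremalDist (fun v => n - 3 - d v) : ℤ) ≤
      excess (fun v => n - 3 - d v) (fun v => n - 3 - m v) := by
        exact_mod_cast extremalDist_le hm.dual
    rw [← he]
    linarith
  have h1 := key d
  have h2 := key fun v => n - 3 - d v
  have h3 : deg (fun v => n - 3 - d v) = n * (n - 3) - deg d := by
    simp [deg, Finset.sum_sub_distrib, n]
    ring
  simp only [sub_sub_cancel, h3] at h2
  linarith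

/-! ### The effect of lowering one coordinate -/

variable [DecidableEq V]

theorem excess_sub_single (d m : V → ℤ) (k : V) (h : m k < d k) :
    excess (d - Pi.single k 1) m + 1 = excess d m := by
  simp only [excess]
  rw [← Finset.add_sum_erase _ _ (Finset.mem_univ k),
    ← Finset.add_sum_erase _ (fun v => (d v - m v).toNat) (Finset.mem_univ k)]
  have : ∑ v ∈ Finset.univ.erase k, ((d - Pi.single k 1 : V → ℤ) v - m v).toNat =
      ∑ v ∈ Finset.univ.erase k, (d v - m v).toNat :=
    Finset.sum_congr rfl fun v hv => by
      simp [Finset.ne_of_mem_erase hv]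
  have hk : (d - Pi.single k 1 : V → ℤ) k = d k - 1 := by simp
  rw [this, hk]
  omega

theorem extremalDist_le_sub_single_add_one [Nonempty V] (d : V → ℤ) (k : V) :
    extremalDist d ≤ extremalDist (d - Pi.single k 1) + 1 := by
  obtain ⟨m, hm, he⟩ := exists_excess_eq (d - Pi.single k 1)
  refine (extremalDist_le hm).trans ?_
  rw [← he]
  by_cases h : m k < d k
  · exact (excess_sub_single d m k h).ge
  · refine (Finset.sum_le_sum fun v _ => ?_).trans (Nat.le_succ _)
    rcases eq_or_ne v k with rfl | hv
    · omega
    · simp [hv]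

/-- If `d` is effective and its `k`-th coordinate vanishes, then some extremal vector closest to
`d` is negative at `k`: given any closest one, exchange its values at `k` and at a coordinate
where it is negative. -/
theorem extremalDist_sub_single_lt [Nonempty V] {d : V → ℤ} {k : V} (h0 : ∀ v, 0 ≤ d v)
    (hk : d k = 0) : extremalDist (d - Pi.single k 1) + 1 ≤ extremalDist d := by
  suffices h : ∃ m, IsExtremal m ∧ m k < 0 ∧ excess d m ≤ extremalDist d by
    obtain ⟨m, hm, hmk, he⟩ := h
    have h1 := excess_sub_single d m k (by omega)
    have h2 := extremalDist_le (d := d - Pi.single k 1) hm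
    omega
  obtain ⟨m, hm, he⟩ := exists_excess_eq d
  by_cases hmk : m k < 0
  · exact ⟨m, hm, hmk, he.le⟩
  obtain ⟨l, hl⟩ := hm.exists_neg
  have hlk : l ≠ k := by rintro rfl; exact hmk hl
  refine ⟨m ∘ Equiv.swap k l, hm.comp_equiv _, by simpa using hl, ?_⟩
  rw [← he]
  simp only [excess, Function.comp_apply]
  have hmem : l ∈ Finset.univ.erase k := by simp [hlk]
  rw [← Finset.add_sum_erase _ _ (Finset.mem_univ k), ← Finset.add_sum_erase _ _ hmem,
    ← Finset.add_sum_erase _ (fun v => (d v - m v).toNat) (Finset.mem_univ k),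
    ← Finset.add_sum_erase _ (fun v => (d v - m v).toNat) hmem]
  have : ∑ v ∈ (Finset.univ.erase k).erase l, (d v - m (Equiv.swap k l v)).toNat =
      ∑ v ∈ (Finset.univ.erase k).erase l, (d v - m v).toNat :=
    Finset.sum_congr rfl fun v hv => by
      simp only [Finset.mem_erase] at hv
      rw [Equiv.swap_apply_of_ne_of_ne hv.2.1 hv.1]
  rw [this, Equiv.swap_apply_left, Equiv.swap_apply_right]
  have := h0 l
  omega

/-- The sum of the residues of `d v - d k` modulo `n = |V|` over all coordinates `v ≠ k, l`. -/
def residueSum (k l : V) (d : V → ℤ) : ℤ :=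
  ∑ v ∈ (Finset.univ.erase k).erase l, (d v - d k) % (Fintype.card V : ℤ)

/-- A normal form for `d` up to equivalence: zero at `k` and reduced modulo `n` away from `k`
and `l`. -/
theorem exists_isPrincipal_normalForm {k l : V} (hkl : l ≠ k) (d : V → ℤ) :
    ∃ x : V → ℤ, IsPrincipal x ∧ (d + x) k = 0 ∧ (d + x) l = deg d - residueSum k l d ∧
      ∀ v, v ≠ k → v ≠ l → (d + x) v = (d v - d k) % (Fintype.card V : ℤ) := by
  set n : ℤ := (Fintype.card V : ℤ) with hn
  have hmem : l ∈ Finset.univ.erase k := by simp [hkl]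
  have hsplit : ∀ g : V → ℤ, ∑ v, g v = g k + (g l + ∑ v ∈ (Finset.univ.erase k).erase l, g v) :=
    fun g => by rw [← Finset.add_sum_erase _ _ (Finset.mem_univ k), ← Finset.add_sum_erase _ _ hmem]
  let r : V → ℤ := fun v => if v = k then 0 else
    if v = l then deg d - residueSum k l d else (d v - d k) % n
  have hr : ∀ v ∈ (Finset.univ.erase k).erase l, r v = (d v - d k) % n := fun v hv => by
    simp only [Finset.mem_erase] at hv
    simp [r, hv.1, hv.2.1]
  have hrsum : ∑ v, r v = deg d := by
    rw [hsplit r, Finset.sum_congr rfl hr]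
    simp [r, hkl, residueSum, hn]
  have hcong : ∀ v, n ∣ r v - (d v - d k) := by
    have h1 : ∀ v, v ≠ l → n ∣ r v - (d v - d k) := by
      intro v hv
      by_cases hvk : v = k
      · simp [r, hvk]
      · simp only [r, hvk, hv, if_false]
        exact (Int.mod_modEq _ _).symm.dvd
    intro v
    rcases eq_or_ne v l with rfl | hv
    -- All other coordinates satisfy the congruence, and `∑ v, (r v - (d v - d k)) = n * d k`.
    · have h2 : ∑ w, (r w - (d w - d k)) = n * d k := by
        rw [Finset.sum_sub_distrib, Finset.sum_sub_distrib, hrsum]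
        simp [deg, hn]
      rw [hsplit] at h2
      have h3 := Finset.dvd_sum (s := (Finset.univ.erase k).erase v) fun w hw =>
        h1 w (Finset.ne_of_mem_erase hw)
      have h4 : r v - (d v - d k) = n * d k - (r k - (d k - d k)) -
          ∑ w ∈ (Finset.univ.erase k).erase v, (r w - (d w - d k)) := by linarith
      rw [h4]
      exact dvd_sub (dvd_sub (dvd_mul_right _ _) (h1 k hkl.symm)) h3
    · exact h1 v hv
  refine ⟨r - d, ⟨?_, fun u v => ?_⟩, by simp [r], by simp [r, hkl], fun v hk hl => ?_⟩
  · simp only [Pi.sub_apply, Finset.sum_sub_distrib, hrsum]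
    simp [deg]
  · have := dvd_sub (hcong u) (hcong v)
    rwa [show r u - (d u - d k) - (r v - (d v - d k)) = (r - d) u - (r - d) v by
      simp only [Pi.sub_apply]; ring] at this
  · simp [r, hk, hl]

/-- The vector `d` is equivalent to an effective vector vanishing at `k`. -/
theorem exists_isPrincipal_nonneg {k l : V} (hkl : l ≠ k) {d : V → ℤ}
    (h : residueSum k l d ≤ deg d) :
    ∃ x : V → ℤ, IsPrincipal x ∧ (d + x) k = 0 ∧ ∀ v, 0 ≤ (d + x) v := by
  obtain ⟨x, hx, hxk, hxl, hxv⟩ := exists_isPrincipal_normalForm hkl d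
  refine ⟨x, hx, hxk, fun v => ?_⟩
  have hn : (Fintype.card V : ℤ) ≠ 0 := by
    exact_mod_cast (Fintype.card_pos_iff.2 ⟨k⟩).ne'
  by_cases h1 : v = k
  · rw [h1, hxk]
  · by_cases h2 : v = l
    · rw [h2, hxl]; omega
    · rw [hxv v h1 h2]; exact Int.emod_nonneg _ hn

theorem extremalDist_sub_single_of_le [Nonempty V] {k l : V} (hkl : l ≠ k) {d : V → ℤ}
    (h : residueSum k l d ≤ deg d) :
    extremalDist d = extremalDist (d - Pi.single k 1) + 1 := by
  obtain ⟨x, hx, hxk, hx0⟩ := exists_isPrincipal_nonneg hkl h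
  have h1 := extremalDist_sub_single_lt hx0 hxk
  rw [show d + x - Pi.single k 1 = d - Pi.single k 1 + x by abel, extremalDist_add _ hx,
    extremalDist_add _ hx] at h1
  exact le_antisymm (extremalDist_le_sub_single_add_one d k) h1

/-- Under the duality `d ↦ K - d`, the step from `d - e_k` to `d` becomes the step from `K - d` to
`K - d + e_k`, and the criterion of `extremalDist_sub_single_of_le` becomes its negation. -/
theorem extremalDist_sub_single_of_lt [Nonempty V] {k l : V} (hkl : l ≠ k) {d : V → ℤ}
    (h : deg d < residueSum k l d) :
    extremalDist d = extremalDist (d - Pi.single k 1) := by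
  set n : ℤ := (Fintype.card V : ℤ) with hn
  have hn0 : 0 < n := by rw [hn]; exact_mod_cast Fintype.card_pos_iff.2 ⟨k⟩
  have hd1 := extremalDist_dual d
  have hd2 := extremalDist_dual (d - Pi.single k 1)
  rw [← hn] at hd1 hd2
  set d' : V → ℤ := fun v => n - 3 - (d - Pi.single k 1 : V → ℤ) v with hd'
  have hd'1 : (fun v => n - 3 - d v) = d' - Pi.single k 1 := by
    funext v; simp [hd']; ring
  have hdeg1 : deg (d - Pi.single k 1) = deg d - 1 := by
    simp [deg, Finset.sum_sub_distrib]
  have hdeg : deg d' = n * (n - 3) - deg d + 1 := by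
    have : deg d' = n * (n - 3) - deg (d - Pi.single k 1) := by
      simp only [deg, hd', Finset.sum_sub_distrib]
      simp [hn]
      ring
    rw [this, hdeg1]; ring
  have hres : residueSum k l d' = (n - 1) * (n - 2) - residueSum k l d := by
    have hcard : ((((Finset.univ : Finset V).erase k).erase l).card : ℤ) = n - 2 := by
      have hmem : l ∈ Finset.univ.erase k := by simp [hkl]
      have h1 := Finset.card_erase_add_one hmem
      have h2 := Finset.card_erase_add_one (Finset.mem_univ k)
      rw [Finset.card_univ] at h2
      omega
    have hterm : ∀ v ∈ ((Finset.univ : Finset V).erase k).erase l,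
        (d' v - d' k) % n = (n - 1) - (d v - d k) % n := by
      intro v hv
      simp only [Finset.mem_erase] at hv
      have hmod : (d' v - d' k) % n = ((n - 1) - (d v - d k) % n) % n := by
        refine Int.modEq_iff_dvd.2 ⟨(d v - d k) / n + 1, ?_⟩
        have := Int.mul_ediv_add_emod (d v - d k) n
        simp only [hd', Pi.sub_apply, Pi.single_eq_same, Pi.single_eq_of_ne hv.2.1]
        linarith
      rw [hmod]
      have := Int.emod_nonneg (d v - d k) hn0.ne'
      have := Int.emod_lt_of_pos (d v - d k) hn0
      exact Int.emod_eq_of_lt (by omega) (by omega)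
    rw [residueSum, residueSum, ← hn, Finset.sum_congr rfl hterm, Finset.sum_sub_distrib,
      Finset.sum_const, nsmul_eq_mul, hcard]
    ring
  have hcrit : residueSum k l d' ≤ deg d' := by
    rw [hres, hdeg]; linarith
  have := extremalDist_sub_single_of_le hkl hcrit
  rw [hd'1] at hd1
  have : (extremalDist d' : ℤ) = extremalDist (d' - Pi.single k 1) + 1 := by exact_mod_cast this
  have : (extremalDist d : ℤ) = extremalDist (d - Pi.single k 1) := by linarith
  exact_mod_cast this

/-- Along `d, d - e_k, d - 2 e_k, …` the value of `extremalDist` drops by one exactly at those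
`d - i e_k` that satisfy the criterion of `extremalDist_sub_single_of_le`, and it ends at zero. -/
theorem extremalDist_eq_card [Nonempty V] {k l : V} (hkl : l ≠ k) (d : V → ℤ) :
    extremalDist d = ((Finset.Icc 0 (deg d)).filter fun i =>
      residueSum k l (d - Pi.single k i) ≤ deg d - i).card := by
  have hdeg : ∀ i, deg (d - Pi.single k i) = deg d - i := fun i => by
    simp [deg, Finset.sum_sub_distrib]
  have hstep : ∀ t : ℕ, extremalDist d = extremalDist (d - Pi.single k (t : ℤ)) +
      ((Finset.range t).filter fun i : ℕ =>
        residueSum k l (d - Pi.single k (i : ℤ)) ≤ deg d - i).card := by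
    intro t
    induction t with
    | zero => simp
    | succ t ih =>
      rw [Finset.range_add_one, Finset.filter_insert]
      have hs : d - Pi.single k ((t + 1 : ℕ) : ℤ) = d - Pi.single k (t : ℤ) - Pi.single k 1 := by
        push_cast; rw [Pi.single_add]; abel
      split_ifs with h
      · rw [Finset.card_insert_of_notMem (by simp), ih, hs,
          extremalDist_sub_single_of_le hkl (by rwa [hdeg])]
        ring
      · rw [ih, hs, extremalDist_sub_single_of_lt hkl (by rw [hdeg]; omega)]
  obtain ⟨m, hm, hdm⟩ := exists_isExtremal_ge d k
  set t : ℕ := (d k - m k).toNat + (deg d + 1).toNat with ht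
  have hzero : extremalDist (d - Pi.single k (t : ℤ)) = 0 := by
    refine extremalDist_eq_zero_iff.2 ⟨m, hm, fun v => ?_⟩
    rcases eq_or_ne v k with rfl | hv
    · simp only [Pi.sub_apply, Pi.single_eq_same]; omega
    · simpa [hv] using hdm v hv
  have hn : (Fintype.card V : ℤ) ≠ 0 := by
    exact_mod_cast (Fintype.card_pos_iff.2 ⟨k⟩).ne'
  rw [hstep t, hzero, zero_add]
  refine Finset.card_bij (fun i _ => (i : ℤ)) ?_ (fun i _ j _ h => by exact_mod_cast h) ?_
  · intro i hi
    rw [Finset.mem_filter] at hi ⊢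
    have : 0 ≤ residueSum k l (d - Pi.single k (i : ℤ)) :=
      Finset.sum_nonneg fun v _ => Int.emod_nonneg _ hn
    refine ⟨Finset.mem_Icc.2 ⟨by omega, by omega⟩, hi.2⟩
  · intro i hi
    rw [Finset.mem_filter, Finset.mem_Icc] at hi
    lift i to ℕ using hi.1.1
    exact ⟨i, Finset.mem_filter.2 ⟨Finset.mem_range.2 (by omega), hi.2⟩, rfl⟩

end Extremal

/-! ### The rank on the complete graph -/

section CompleteGraph

variable {V : Type*} [Fintype V] [DecidableEq V] [DecidableRel (⊤ : SimpleGraph V).Adj]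

theorem lapMatrix_top_mulVec (x : V → ℤ) (v : V) :
    (((⊤ : SimpleGraph V).lapMatrix ℤ).mulVec x) v = Fintype.card V * x v - ∑ u, x u := by
  have hnb : (⊤ : SimpleGraph V).neighborFinset v = Finset.univ.erase v := by
    ext u; simp [eq_comm]
  have hpos : 1 ≤ Fintype.card V := Fintype.card_pos_iff.2 ⟨v⟩
  rw [SimpleGraph.lapMatrix_mulVec_apply, ← SimpleGraph.card_neighborFinset_eq_degree, hnb,
    Finset.card_erase_of_mem (Finset.mem_univ v), Finset.card_univ,
    ← Finset.add_sum_erase _ x (Finset.mem_univ v)]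
  push_cast [hpos]
  ring

theorem equivalent_top_iff (d d' : V → ℤ) :
    Equivalent (⊤ : SimpleGraph V) d d' ↔ IsPrincipal (d - d') := by
  constructor
  · rintro ⟨x, hx⟩
    rw [hx]
    constructor
    · simp [lapMatrix_top_mulVec, Finset.sum_sub_distrib, ← Finset.mul_sum]
    · intro u v
      exact ⟨x u - x v, by rw [lapMatrix_top_mulVec, lapMatrix_top_mulVec]; ring⟩
  · rintro ⟨h0, h⟩
    rcases isEmpty_or_nonempty V with hV | ⟨⟨w⟩⟩
    · exact ⟨0, Subsingleton.elim _ _⟩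
    choose y hy using fun v => h v w
    have hn : (Fintype.card V : ℤ) ≠ 0 := by
      exact_mod_cast (Fintype.card_pos_iff.2 ⟨w⟩).ne'
    -- Summing `(d - d') v = n * y v + (d - d') w` over `v` gives `∑ y = - (d - d') w`.
    have hsum : ∑ v, y v = -(d - d') w := by
      have h1 : ∑ v, ((d - d') v - (d - d') w) = ∑ v, (Fintype.card V : ℤ) * y v :=
        Finset.sum_congr rfl fun v _ => hy v
      rw [Finset.sum_sub_distrib, h0, ← Finset.mul_sum, Finset.sum_const, nsmul_eq_mul,
        Finset.card_univ, zero_sub, ← mul_neg] at h1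
      exact (mul_left_cancel₀ hn h1).symm
    refine ⟨y, funext fun v => ?_⟩
    rw [lapMatrix_top_mulVec, hsum, ← hy v]
    ring

theorem IsExtremal.mem_nonEffective [Nonempty V] {d m : V → ℤ} (hm : IsExtremal m) (h : d ≤ m) :
    d ∈ nonEffective (⊤ : SimpleGraph V) := by
  rintro ⟨d', hd', he⟩
  have hp := (equivalent_top_iff _ _).1 he
  obtain ⟨v, hv⟩ := (hm.add hp.neg).exists_neg
  have h1 : d v ≤ m v := h v
  have h2 := hd' v
  simp only [Pi.add_apply, Pi.neg_apply, Pi.sub_apply, Pi.zero_apply] at hv h2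
  omega

/-- A vector that is not equivalent to an effective one satisfies none of the criteria counted
by `extremalDist_eq_card`, hence lies below an extremal vector. -/
theorem extremalDist_eq_zero_of_mem_nonEffective {k l : V} (hkl : l ≠ k) {d : V → ℤ}
    (hd : d ∈ nonEffective (⊤ : SimpleGraph V)) : extremalDist d = 0 := by
  have : Nonempty V := ⟨k⟩
  rw [extremalDist_eq_card hkl, Finset.card_eq_zero, Finset.filter_eq_empty_iff]
  intro i hi hle
  rw [Finset.mem_Icc] at hi
  have hdeg : deg (d - Pi.single k i) = deg d - i := by
    simp [deg, Finset.sum_sub_distrib]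
  obtain ⟨x, hx, -, hx0⟩ := exists_isPrincipal_nonneg hkl (hle.trans_eq hdeg.symm)
  refine hd ⟨d + x, fun v => ?_, (equivalent_top_iff _ _).2 (by simpa using hx.neg)⟩
  have h1 : 0 ≤ (d - Pi.single k i + x : V → ℤ) v := hx0 v
  have h2 : 0 ≤ Pi.single (M := fun _ => ℤ) k i v := by
    rcases eq_or_ne v k with rfl | hv
    · simpa using hi.1
    · simp [hv]
  simp only [Pi.add_apply, Pi.sub_apply, Pi.zero_apply] at h1 ⊢
  omega

theorem distNonEffective_top_eq_extremalDist {k l : V} (hkl : l ≠ k) (d : V → ℤ) :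
    distNonEffective (⊤ : SimpleGraph V) d = extremalDist d := by
  have : Nonempty V := ⟨k⟩
  obtain ⟨m, hm, he⟩ := exists_excess_eq d
  have hmem : ∃ d' ∈ nonEffective (⊤ : SimpleGraph V), l1Dist d d' = extremalDist d := by
    refine ⟨d ⊓ m, hm.mem_nonEffective inf_le_right, ?_⟩
    rw [← he]
    exact Finset.sum_congr rfl fun v _ => by simp only [Pi.inf_apply]; omega
  refine le_antisymm (Nat.sInf_le hmem) (le_csInf ⟨_, hmem⟩ ?_)
  rintro c ⟨d', hd', rfl⟩
  obtain ⟨m', hm', hle⟩ :=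
    extremalDist_eq_zero_iff.1 (extremalDist_eq_zero_of_mem_nonEffective hkl hd')
  refine (extremalDist_le hm').trans (Finset.sum_le_sum fun v _ => ?_)
  have : d' v ≤ m' v := hle v
  omega

end CompleteGraph

theorem rankComplete_eq (n : ℕ) (hn : 2 ≤ n) (d : Fin n → ℤ) :
    rankComplete n d = -1 + (((Finset.Icc (0 : ℤ) (deg d)).filter fun i =>
      ∑ j : Fin (n - 2), (d ⟨j, by omega⟩ - d ⟨n - 2, by omega⟩ + i) % (n : ℤ) ≤
        deg d - i).card : ℤ) := by
  obtain ⟨p, rfl⟩ : ∃ p, n = p + 2 := ⟨n - 2, by omega⟩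
  have hkl : (Fin.last (p + 1)) ≠ (Fin.last p).castSucc := (Fin.castSucc_lt_last _).ne'
  have hres : ∀ i, residueSum (Fin.last p).castSucc (Fin.last (p + 1))
      (d - Pi.single (Fin.last p).castSucc i) =
      ∑ j : Fin p, (d j.castSucc.castSucc - d (Fin.last p).castSucc + i) % ((p + 2 : ℕ) : ℤ) := by
    intro i
    have hset : ((Finset.univ : Finset (Fin (p + 2))).erase (Fin.last p).castSucc).erase
        (Fin.last (p + 1)) = Finset.univ.map (Fin.castSuccEmb.trans Fin.castSuccEmb) := by
      ext v
      refine Fin.lastCases ?_ (fun v => Fin.lastCases ?_ (fun v => ?_) v) v <;>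
        simp [Fin.ext_iff] <;> omega
    rw [residueSum, hset, Finset.sum_map, Fintype.card_fin]
    refine Finset.sum_congr rfl fun j _ => ?_
    have hj : j.castSucc.castSucc ≠ (Fin.last p).castSucc := by
      simp [Fin.ext_iff]; omega
    simp only [Function.Embedding.trans_apply, Fin.coe_castSuccEmb, Pi.sub_apply,
      Pi.single_eq_same, Pi.single_eq_of_ne hj]
    congr 1; ring
  rw [rankComplete, rank, distNonEffective_top_eq_extremalDist hkl, extremalDist_eq_card hkl]
  simp only [hres]
  rw [sub_eq_add_neg, add_comm]
  rfl

end BakerNorine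

namespace BakerNorine

/-! ### Counting by residue classes -/

/-- Counting by residue classes: in the class of `r` the condition `s i ≤ D - i` reads
`n * q ≤ D - r - s r`, where `i = r + n * q`. -/
theorem card_filter_le_sub_eq_sum {n : ℕ} (hn : 0 < n) (s : ℤ → ℤ)
    (hs : ∀ i q, s (i + n * q) = s i) (hs0 : ∀ i, 0 ≤ s i) (D : ℤ) :
    (((Finset.Icc 0 D).filter fun i => s i ≤ D - i).card : ℤ) =
      ∑ r ∈ Finset.range n, max 0 ((n + D - (r + s r)) / n) := by
  have hn0 : (0 : ℤ) < n := by exact_mod_cast hn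
  rw [Finset.card_eq_sum_card_fiberwise (f := fun i : ℤ => (i % n).toNat) (t := Finset.range n)]
  · rw [Nat.cast_sum]
    refine Finset.sum_congr rfl fun r hr => ?_
    rw [Finset.mem_range] at hr
    have hmod : ∀ q : ℤ, ((r : ℤ) + n * q) % n = r := fun q => by
      rw [Int.add_mul_emod_self_left, Int.emod_eq_of_lt (by omega) (by omega)]
    have hiff : ∀ q : ℕ, q < ((n + D - (r + s r)) / n).toNat ↔ s r ≤ D - (r + n * q) := by
      intro q
      rw [Int.lt_toNat, ← Int.add_one_le_iff, Int.le_ediv_iff_mul_le hn0, add_mul, one_mul,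
        mul_comm (q : ℤ)]
      constructor <;> intro h <;> linarith
    have hcard : ((((Finset.Icc 0 D).filter fun i => s i ≤ D - i).filter
        fun i : ℤ => (i % n).toNat = r).card) = ((n + D - (r + s r)) / n).toNat := by
      rw [← Finset.card_range ((n + D - (r + s r)) / n).toNat]
      symm
      refine Finset.card_bij (fun q _ => (r : ℤ) + n * q) ?_ ?_ ?_
      · intro q hq
        rw [Finset.mem_range, hiff] at hq
        have h0 : (0 : ℤ) ≤ n * q := by positivity
        have := hs0 r
        simp only [Finset.mem_filter, Finset.mem_Icc, hs, hmod]
        refine ⟨⟨⟨by omega, by omega⟩, hq⟩, by simp⟩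
      · intro q _ q' _ h
        have := mul_left_cancel₀ hn0.ne' (add_left_cancel h)
        exact_mod_cast this
      · intro i hi
        simp only [Finset.mem_filter, Finset.mem_Icc] at hi
        obtain ⟨⟨⟨hi0, -⟩, hle⟩, hir⟩ := hi
        have h1 := Int.mul_ediv_add_emod i n
        have h2 := Int.emod_nonneg i hn0.ne'
        have h3 : ((i / n).toNat : ℤ) = i / n := Int.toNat_of_nonneg (Int.ediv_nonneg hi0 hn0.le)
        have h4 : (r : ℤ) + n * ((i / n).toNat : ℤ) = i := by rw [h3]; omega
        refine ⟨(i / n).toNat, ?_, h4⟩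
        rw [Finset.mem_range, hiff, h4, ← hs r ((i / n).toNat : ℤ), h4]
        exact hle
    rw [hcard, Int.toNat_eq_max, max_comm]
  · intro i _
    have h1 := Int.emod_nonneg i hn0.ne'
    have h2 := Int.emod_lt_of_pos i hn0
    simp only [Finset.coe_range, Set.mem_Iio]
    omega

/-- Shifting a residue by one adds one, except at the wrap-around. -/
theorem emod_shift_succ {n b j : ℤ} (hb0 : 0 ≤ b) (hb : b < n) (hj0 : 0 ≤ j) (hj : j < n) :
    (b + (n - j)) % n = (b + (n - (j + 1))) % n + 1 - if b = j then n else 0 := by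
  have hwrap : ∀ x, (x + n) % n = x % n := fun x => Int.add_emod_right x n
  rcases lt_trichotomy b j with h | rfl | h
  · rw [if_neg h.ne, Int.emod_eq_of_lt (by omega) (by omega),
      Int.emod_eq_of_lt (by omega) (by omega)]
    ring
  · rw [if_pos rfl, Int.emod_eq_of_lt (by omega) (by omega : b + (n - (b + 1)) < n)]
    rw [show b + (n - b) = n by ring, Int.emod_self]
    ring
  · rw [if_neg h.ne', show b + (n - j) = b - j + n by ring,
      show b + (n - (j + 1)) = b - j - 1 + n by ring, hwrap, hwrap,
      Int.emod_eq_of_lt (by omega) (by omega), Int.emod_eq_of_lt (by omega) (by omega)]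
    ring

end BakerNorine

namespace RAM

/-! ### The program -/

/-- Computes the rank on `K_n`.  Instructions `6`-`17` run over the coordinates `d_j`, `j ≤ n - 2`
(numbered from `0`): with `b_j = (d_j - d_{n-2}) mod n` they accumulate `n + deg d - ∑ b_j` in
register `4` and add `n` to the memory cell `n + b_j`.  Instructions `20`-`30` run over
`i = 0, …, n - 1`, with `n - 1 - i` in register `2` and
`u_i = n + deg d - ∑ ((b_j + i) mod n)` in register `4`, and add `max 0 (u_i / n)` to register
`8`. -/
def rankProgram : Program :=
  [.const 1 1,
   .sub 2 0 1,
   .load 4 2,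
   .add 4 4 0,
   .sub 2 2 1,
   .load 3 2,
   .jumpNeg 2 18,
   .load 5 2,
   .add 4 4 5,
   .sub 5 5 3,
   .mod 5 5 0,
   .sub 4 4 5,
   .add 5 5 0,
   .load 6 5,
   .add 6 6 0,
   .store 5 6,
   .sub 2 2 1,
   .jump 6,
   .sub 2 0 1,
   .const 8 (-1),
   .jumpNeg 2 31,
   .div 5 4 0,
   .jumpNeg 5 24,
   .add 8 8 5,
   .add 5 0 2,
   .load 6 5,
   .add 4 4 6,
   .sub 4 4 0,
   .add 4 4 1,
   .sub 2 2 1,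
   .jump 20,
   .const 0 0,
   .add 0 0 8]

theorem iterate_histogram_body (σ : State) (hpc : σ.pc = 6) (h : 0 ≤ σ.reg 2) :
    ∃ τ, (step rankProgram)^[12] σ = τ ∧ τ.pc = 6 ∧
      τ.mem = Function.update σ.mem ((σ.mem (σ.reg 2) - σ.reg 3) % σ.reg 0 + σ.reg 0)
        (σ.mem ((σ.mem (σ.reg 2) - σ.reg 3) % σ.reg 0 + σ.reg 0) + σ.reg 0) ∧
      τ.reg 0 = σ.reg 0 ∧ τ.reg 1 = σ.reg 1 ∧ τ.reg 2 = σ.reg 2 - σ.reg 1 ∧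
      τ.reg 3 = σ.reg 3 ∧
      τ.reg 4 = σ.reg 4 + σ.mem (σ.reg 2) - (σ.mem (σ.reg 2) - σ.reg 3) % σ.reg 0 := by
  obtain ⟨pc, reg, mem⟩ := σ
  obtain rfl : pc = 6 := hpc
  refine ⟨_, rfl, ?_⟩
  simp [Function.iterate_succ_apply, step, rankProgram, Instr.exec, State.setReg, h.not_gt]

theorem iterate_count_body (σ : State) (hpc : σ.pc = 20) (h : 0 ≤ σ.reg 2) :
    ∃ t ≤ 11, ∃ τ, (step rankProgram)^[t] σ = τ ∧ τ.pc = 20 ∧ τ.mem = σ.mem ∧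
      τ.reg 0 = σ.reg 0 ∧ τ.reg 1 = σ.reg 1 ∧ τ.reg 2 = σ.reg 2 - σ.reg 1 ∧
      τ.reg 4 = σ.reg 4 + σ.mem (σ.reg 0 + σ.reg 2) - σ.reg 0 + σ.reg 1 ∧
      τ.reg 8 = σ.reg 8 + max 0 (σ.reg 4 / σ.reg 0) := by
  obtain ⟨pc, reg, mem⟩ := σ
  obtain rfl : pc = 20 := hpc
  by_cases hq : reg 4 / reg 0 < 0
  · refine ⟨10, by norm_num, _, rfl, ?_⟩
    simp [Function.iterate_succ_apply, step, rankProgram, Instr.exec, State.setReg, h.not_gt, hq,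
      max_eq_left hq.le]
  · refine ⟨11, by norm_num, _, rfl, ?_⟩
    simp [Function.iterate_succ_apply, step, rankProgram, Instr.exec, State.setReg, h.not_gt, hq,
      max_eq_right (not_lt.1 hq)]

/-- The first loop, entered with `k` coordinates left to treat. -/
theorem iterate_histogram (n : ℕ) (c : ℤ) (D : ℕ → ℤ) (k : ℕ) (hk : k ≤ n) (σ : State)
    (hpc : σ.pc = 6) (h0 : σ.reg 0 = n) (h1 : σ.reg 1 = 1) (h2 : σ.reg 2 = k - 1)
    (h3 : σ.reg 3 = c) (hmem : ∀ j < k, σ.mem j = D j) :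
    ∃ t ≤ 12 * k + 1, ∃ τ, (step rankProgram)^[t] σ = τ ∧ τ.pc = 18 ∧ τ.reg 0 = n ∧
      τ.reg 1 = 1 ∧ τ.reg 4 = σ.reg 4 + ∑ j ∈ Finset.range k, (D j - (D j - c) % n) ∧
      ∀ x : ℤ, τ.mem (x + n) = σ.mem (x + n) +
        ∑ j ∈ Finset.range k, if (D j - c) % n = x then (n : ℤ) else 0 := by
  induction k generalizing σ with
  | zero =>
    obtain ⟨pc, reg, mem⟩ := σ
    obtain rfl : pc = 6 := hpc
    dsimp only at h0 h1 h2 h3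
    refine ⟨1, by norm_num, _, rfl, ?_⟩
    simp [step, rankProgram, Instr.exec, h0, h1, h2]
  | succ k ih =>
    have h2' : σ.reg 2 = k := by rw [h2]; push_cast; ring
    obtain ⟨τ, hτ, gpc, gmem, g0, g1, g2, g3, g4⟩ :=
      iterate_histogram_body σ hpc (by rw [h2']; positivity)
    rw [h2', hmem k (by omega), h3, h0] at gmem
    rw [h2', hmem k (by omega), h3, h0] at g4
    have hn0 : (n : ℤ) ≠ 0 := by exact_mod_cast (by omega : n ≠ 0)
    have hb := Int.emod_nonneg (D k - c) hn0
    obtain ⟨t, ht, υ, hυ, upc, u0, u1, u4, umem⟩ := ih (by omega) τ gpc (by rw [g0, h0])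
      (by rw [g1, h1]) (by rw [g2, h2', h1]) (by rw [g3, h3]) (fun j hj => by
        rw [gmem, Function.update_of_ne (by omega)]
        exact hmem j (by omega))
    refine ⟨t + 12, by omega, υ, by rw [Function.iterate_add_apply, hτ, hυ], upc, u0, u1, ?_, ?_⟩
    · rw [u4, g4, Finset.sum_range_succ]; ring
    · intro x
      rw [umem, gmem, Finset.sum_range_succ]
      by_cases hx : (D k - c) % n = x
      · subst hx
        rw [Function.update_self, if_pos rfl]; ring
      · rw [Function.update_of_ne (fun h => hx (by omega)), if_neg hx, add_zero]

/-- The second loop, entered with `k` values of the shift left to treat; `W (j + 1)` is the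
content of register `4` when register `2` contains `j`. -/
theorem iterate_count (n : ℕ) (W : ℕ → ℤ) (k : ℕ) (σ : State)
    (hpc : σ.pc = 20) (h0 : σ.reg 0 = n) (h1 : σ.reg 1 = 1) (h2 : σ.reg 2 = k - 1)
    (h4 : σ.reg 4 = W k) (hW : ∀ j < k, W j = W (j + 1) + σ.mem (j + n) - n + 1) :
    ∃ t ≤ 11 * k + 3, ∃ τ, (step rankProgram)^[t] σ = τ ∧ τ.pc = 33 ∧
      τ.reg 0 = σ.reg 8 + ∑ j ∈ Finset.range k, max 0 (W (j + 1) / n) := by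
  induction k generalizing σ with
  | zero =>
    obtain ⟨pc, reg, mem⟩ := σ
    obtain rfl : pc = 20 := hpc
    dsimp only at h0 h1 h2
    refine ⟨3, by norm_num, _, rfl, ?_⟩
    simp [Function.iterate_succ_apply, step, rankProgram, Instr.exec, State.setReg, h2]
  | succ k ih =>
    have h2' : σ.reg 2 = k := by rw [h2]; push_cast; ring
    obtain ⟨s, hs, τ, hτ, gpc, gmem, g0, g1, g2, g4, g8⟩ :=
      iterate_count_body σ hpc (by rw [h2']; positivity)
    obtain ⟨t, ht, υ, hυ, upc, u0⟩ := ih τ gpc (by rw [g0, h0])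
      (by rw [g1, h1]) (by rw [g2, h2', h1])
      (by rw [g4, h4, h0, h1, h2', hW k (by omega), add_comm (n : ℤ)])
      (fun j hj => by rw [gmem]; exact hW j (by omega))
    refine ⟨t + s, by omega, υ, by rw [Function.iterate_add_apply, hτ, hυ], upc, ?_⟩
    rw [u0, g8, h4, h0, Finset.sum_range_succ]; ring

theorem outputs_rankProgram (n : ℕ) (hn : 2 ≤ n) (d : Fin n → ℤ) :
    Outputs rankProgram n d (50 * n) (BakerNorine.rankComplete n d) := by
  obtain ⟨p, hp⟩ : ∃ p, n = p + 2 := ⟨n - 2, by omega⟩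
  have hn0 : (0 : ℤ) < n := by omega
  set D : ℕ → ℤ := fun j => (initial n d).mem j with hD
  have hDd : ∀ j : Fin n, D j = d j := fun j => by simp [hD, initial]
  set c := D p with hc
  -- `T i` is the sum of the shifted residues of all coordinates except the last one.
  set T : ℤ → ℤ := fun i => ∑ j ∈ Finset.range (p + 1), ((D j - c) % n + i) % n with hT
  have hdeg : BakerNorine.deg d = ∑ j ∈ Finset.range (p + 1), D j + D (p + 1) := by
    rw [← Finset.sum_range_succ, ← hp, ← Fin.sum_univ_eq_sum_range]
    exact Finset.sum_congr rfl fun j _ => (hDd j).symm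
  -- Initialization.
  obtain ⟨σ, hσ, spc, s0, s1, s2, s3, s4, smem⟩ : ∃ σ, (step rankProgram)^[6] (initial n d) = σ ∧
      σ.pc = 6 ∧ σ.reg 0 = n ∧ σ.reg 1 = 1 ∧ σ.reg 2 = (p + 1 : ℕ) - 1 ∧ σ.reg 3 = c ∧
      σ.reg 4 = D (p + 1) + n ∧ σ.mem = (initial n d).mem := by
    have e1 : (n : ℤ) - 1 = (p + 1 : ℕ) := by omega
    refine ⟨_, rfl, ?_⟩
    have hreg : (initial n d).reg = fun r => if r = 0 then (n : ℤ) else 0 := rfl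
    have hpc : (initial n d).pc = 0 := rfl
    generalize hm : (initial n d).mem = mem at *
    simp only [hc, hD]
    generalize initial n d = σ at *
    obtain ⟨pc, reg, mem⟩ := σ
    dsimp only at hreg hpc hm
    subst hreg hpc hm
    simp [Function.iterate_succ_apply, step, rankProgram, Instr.exec, State.setReg, e1]
  obtain ⟨t1, ht1, τ, hτ, tpc, t0, t1', t4, tmem⟩ := iterate_histogram n c D (p + 1) (by omega) σ
    spc s0 s1 s2 s3 (fun j _ => by rw [smem])
  -- Initialization of the second loop.
  obtain ⟨υ, hυ, upc, u0, u1, u2, u4, u8, umem⟩ : ∃ υ, (step rankProgram)^[2] τ = υ ∧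
      υ.pc = 20 ∧ υ.reg 0 = n ∧ υ.reg 1 = 1 ∧ υ.reg 2 = n - 1 ∧ υ.reg 4 = τ.reg 4 ∧
      υ.reg 8 = -1 ∧ υ.mem = τ.mem := by
    refine ⟨_, rfl, ?_⟩
    obtain ⟨pc, reg, mem⟩ := τ
    dsimp only at tpc t0 t1'
    subst tpc
    simp [Function.iterate_succ_apply, step, rankProgram, Instr.exec, State.setReg, t0, t1']
  have hW0 : υ.reg 4 = n + BakerNorine.deg d - T (n - n) := by
    rw [u4, t4, s4, hdeg, Finset.sum_sub_distrib]
    simp only [hT, sub_self, add_zero, Int.emod_emod_of_dvd _ (dvd_refl _)]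
    ring
  have hWstep : ∀ j < n, (n : ℤ) + BakerNorine.deg d - T (n - j) =
      n + BakerNorine.deg d - T (n - (j + 1 : ℕ)) + υ.mem (j + n) - n + 1 := by
    intro j hj
    have hz : σ.mem ((j : ℤ) + n) = 0 := by
      rw [smem]; simp [initial]
    have hTj : T (n - j) = T (n - (j + 1 : ℕ)) + (p + 1 : ℕ) -
        ∑ i ∈ Finset.range (p + 1), if (D i - c) % n = j then (n : ℤ) else 0 := by
      rw [hT]
      simp only [Nat.cast_add, Nat.cast_one]
      rw [Finset.sum_congr rfl fun i _ => BakerNorine.emod_shift_succ (Int.emod_nonneg (D i - c) hn0.ne')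
        (Int.emod_lt_of_pos _ hn0) (Int.natCast_nonneg j) (by omega : (j : ℤ) < n), Finset.sum_sub_distrib,
        Finset.sum_add_distrib]
      simp
    rw [umem, tmem, hz, hTj]
    omega
  obtain ⟨t2, ht2, ω, hω, wpc, w0⟩ := iterate_count n
    (fun j => n + BakerNorine.deg d - T (n - j)) n υ upc u0 u1 u2 hW0 hWstep
  refine ⟨t2 + (2 + (t1 + 6)), by omega, ?_⟩
  rw [Function.iterate_add_apply, Function.iterate_add_apply, Function.iterate_add_apply, hσ, hτ,
    hυ, hω]
  refine ⟨by rw [wpc]; rfl, ?_⟩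
  rw [w0, u8, BakerNorine.rankComplete_eq n hn]
  congr 1
  rw [BakerNorine.card_filter_le_sub_eq_sum (n := n) (by omega)
    (fun i => ∑ j : Fin (n - 2), (d ⟨j, by omega⟩ - d ⟨n - 2, by omega⟩ + i) % (n : ℤ))
    (fun i q => Finset.sum_congr rfl fun j _ => by rw [← add_assoc, Int.add_mul_emod_self_left])
    (fun i => Finset.sum_nonneg fun j _ => Int.emod_nonneg _ hn0.ne'), ← Finset.sum_range_reflect]
  refine Finset.sum_congr rfl fun r hr => ?_
  rw [Finset.mem_range] at hr
  have hTr : T r = r + ∑ j : Fin (n - 2),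
      (d ⟨j, by omega⟩ - d ⟨n - 2, by omega⟩ + r) % (n : ℤ) := by
    simp only [hT, Int.emod_add_emod]
    rw [Finset.sum_range_succ, hc, sub_self, zero_add, Int.emod_eq_of_lt (by omega) (by omega),
      add_comm, show Finset.range p = Finset.range (n - 2) by rw [hp]; rfl,
      ← Fin.sum_univ_eq_sum_range (fun j => (D j - D p + r) % (n : ℤ))]
    congr 1
    refine Finset.sum_congr rfl fun j _ => ?_
    have hDp : D p = d ⟨n - 2, by omega⟩ := by
      rw [← hDd]; congr 1; simp only; omega
    rw [← hDd ⟨j, by omega⟩, hDp]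
  rw [← hTr]
  congr 4
  omega

end RAM

theorem mainTheorem2 :
    (∀ (n : ℕ) (hn : 2 ≤ n), ∀ a ∈ BakerNorine.picReps n hn,
      BakerNorine.rankComplete n a = -1 +
        (((Finset.Icc (0 : ℤ) (BakerNorine.deg a)).filter fun i =>
          ∑ j : Fin (n - 2), (a ⟨j, by omega⟩ + i) % (n : ℤ) ≤ BakerNorine.deg a - i).card : ℤ)) ∧
    (∀ (n : ℕ) (hn : 2 ≤ n) (d : Fin n → ℤ),
      BakerNorine.rankComplete n d = -1 +
        (((Finset.Icc (0 : ℤ) (BakerNorine.deg d)).filter fun i =>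
          ∑ j : Fin (n - 2), (d ⟨j, by omega⟩ - d ⟨n - 2, by omega⟩ + i) % (n : ℤ) ≤
            BakerNorine.deg d - i).card : ℤ)) ∧
    (∃ (P : RAM.Program) (C : ℕ), ∀ (n : ℕ), 2 ≤ n → ∀ d : Fin n → ℤ,
      RAM.Outputs P n d (C * n) (BakerNorine.rankComplete n d)) := by
  refine ⟨fun n hn a ha => ?_, BakerNorine.rankComplete_eq, RAM.rankProgram, 50,
    RAM.outputs_rankProgram⟩
  rw [BakerNorine.rankComplete_eq n hn, ha.2]
  simp only [sub_zero]
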